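/- Let $\square=(0,1)^2\subset\mathbb R^2$ and let $G_0$ be a finite union of smooth domains with pairwise disjoint closures, $\overline{G_0}\subset\square$. Let $Y=\overline{\square}\setminus\overline{G_0}$, and assume that $Y$ is connected and symmetric with respect to both lines $\{\xi_1=\tfrac12\}$ and $\{\xi_2=\tfrac12\}$. Put $E=\bigcup_{k\in\mathbb Z^2}(Y+k)$, let $\nu=(\nu_1,\nu_2)$ be the unit normal to $\partial G_0$ exterior to $Y$, and $\langle N\rangle_Y=\frac1{|Y|}\int_Y N\,d\xi$. Let $H^1_{per}(Y)$ be the space of functions on $E$ that are $1$-periodic in $\xi_1$ and $\xi_2$ and have weak first derivatives on $E$, the functions and these derivatives being square integrable over $Y$. For words $\alpha=(\alpha_1,\dots,\alpha_k)$, $\alpha_i\in\{1,2\}$, $|\alpha|=k$, let $N_\alpha$ ($k\ge 0$) be functions and $h_\alpha$ ($k\ge 2$) real constants such that $N_\alpha\equiv 1$ for the empty word and, for $k\ge1$, $N_\alpha\in H^1_{per}(Y)$ is a weak solution of the following problem: for $k=1$, $$\Delta N_\alpha=0\ \text{ in } Y,\qquad \partial_\nu N_\alpha=-\nu_{\alpha_1}\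 \text{ on }\partial G_0,\qquad \langle N_\alpha\rangle_Y=0,$$ and for $k\ge 2$, $$\Delta N_\alpha=h_\alpha-\delta_{\alpha_1,\alpha_2}N_{\alpha_3\dots\alpha_k}-2\,\partial_{\xi_{\alpha_1}}N_{\alpha_2\dots\alpha_k}\ \text{ in }Y,\qquad \partial_\nu N_\alpha=-\nu_{\alpha_1}N_{\alpha_2\dots\alpha_k}\ \text{ on }\partial G_0,\qquad\langle N_\alpha\rangle_Y=0.$$ Here a weak solution $N\in H^1_{per}(Y)$ of $\Delta N=F_0+\sum_i\partial_{\xi_i}F_i$ in $Y$, $\partial_\nu N=\sum_iF_i\nu_i$ on $\partial G_0$, is one with $-\int_Y\nabla N\cdot\nabla\varphi\,d\xi=\int_Y F_0\varphi\,d\xi-\int_Y\sum_iF_i\,\partial_{\xi_i}\varphi\,d\xi$ for all $\varphi\in H^1_{per}(Y)$; for $k\ge 1$ one takes $F_i=-\delta_{i,\alpha_1}N_{\alpha_2\dots\alpha_k}$, with $F_0=0$ if $k=1$ and $F_0=h_\alpha-\delta_{\alpha_1,\alpha_2}N_{\alpha_3\dots\alpha_k}-\partial_{\xi_{\alpha_1}}N_{\alpha_2\dots\alpha_k}$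 if $k\ge 2$. Let $S_l$ ($l=1,2$) be the reflection that changes the sign of the coordinate $\xi_l$. Then for every $\alpha$ with $|\alpha|\ge1$ and every $l\in\{1,2\}$ $$N_\alpha(S_l\xi)=(-1)^{\delta_{\alpha_1,l}+\dots+\delta_{\alpha_k,l}}N_\alpha(\xi)$$ for almost every $\xi\in E$, and for every $\xi\in\overline E$ if $N_\alpha$ is continuous on $\overline E$. Moreover, for $|\alpha|\ge2$, $h_\alpha=0$ if $|\alpha|$ is odd, and $h_\alpha=0$ if $(-1)^{\delta_{\alpha_1,l}+\dots+\delta_{\alpha_k,l}}=-1$ for at least one $l\in\{1,2\}$. -/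

import Mathlib

open MeasureTheory Topology
open scoped ContDiff

noncomputable section

namespace CellProblem

/-- The Euclidean plane `ℝ²`. The coordinate indices `1, 2` are `0, 1 : Fin 2`. -/
abbrev Plane : Type := EuclideanSpace ℝ (Fin 2)

/-- The open unit square. -/
def openSquare : Set Plane := {ξ | ∀ i, 0 < ξ i ∧ ξ i < 1}

/-- The closed unit square. -/
def closedSquare : Set Plane := {ξ | ∀ i, 0 ≤ ξ i ∧ ξ i ≤ 1}

/-- A smooth domain: a nonempty connected open set which near each of its boundary points is the
sublevel set `{ρ < 0}` of a `C^∞` function `ρ` whose differential does not vanish there. -/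
def IsSmoothDomain (U : Set Plane) : Prop :=
  IsOpen U ∧ IsConnected U ∧
    ∀ x ∈ frontier U, ∃ V ∈ 𝓝 x, ∃ ρ : Plane → ℝ,
      ContDiff ℝ ∞ ρ ∧ fderiv ℝ ρ x ≠ 0 ∧ U ∩ V = {y | ρ y < 0} ∩ V

/-- The periodicity cell `Y`: the closed unit square without the closed holes. -/
def cell (G : Set Plane) : Set Plane := closedSquare \ closure G

/-- The point of the integer lattice with coordinates `k`. -/
def lattice (k : Fin 2 → ℤ) : Plane := WithLp.toLp 2 fun i => (k i : ℝ)

/-- The perforated plane, the union of all translates of the cell by integer vectors. -/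
def perforatedPlane (G : Set Plane) : Set Plane := {ξ | ∃ k : Fin 2 → ℤ, ξ - lattice k ∈ cell G}

/-- The reflection `S_l`, which changes the sign of the coordinate `ξ_l`. -/
def reflect (l : Fin 2) (ξ : Plane) : Plane := WithLp.toLp 2 fun i => if i = l then -ξ i else ξ i

/-- The reflection in the line `ξ_l = 1/2`. -/
def mirror (l : Fin 2) (ξ : Plane) : Plane := WithLp.toLp 2 fun i => if i = l then 1 - ξ i else ξ i

/-- `G` is the set of holes of a symmetric perforated cell: a finite union of smooth domains with
pairwise disjoint closures (disjoint and not touching each other), whose closure lies in the open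
unit square, such that the cell is connected and symmetric in both lines `ξ_l = 1/2`. -/
structure IsSymmetricPerforation (G : Set Plane) : Prop where
  holes : ∃ (n : ℕ) (D : Fin n → Set Plane), (∀ i, IsSmoothDomain (D i)) ∧
    (∀ i j, i ≠ j → Disjoint (closure (D i)) (closure (D j))) ∧ G = ⋃ i, D i
  strictly_inside : closure G ⊆ openSquare
  connected : IsConnected (cell G)
  symmetric : ∀ l, mirror l ⁻¹' cell G = cell G

/-- `g` is the weak partial derivative of `f` with respect to the `i`-th coordinate on `U`. -/
def HasWeakPartial (U : Set Plane) (f g : Plane → ℝ) (i : Fin 2) : Prop :=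
  LocallyIntegrableOn f U ∧ LocallyIntegrableOn g U ∧
    ∀ ψ : Plane → ℝ, ContDiff ℝ ∞ ψ → HasCompactSupport ψ → tsupport ψ ⊆ U →
      ∫ ξ in U, f ξ * fderiv ℝ ψ ξ (EuclideanSpace.single i 1) = -∫ ξ in U, g ξ * ψ ξ

/-- `u` (a representative of) an element of `H¹_per(Y)` with weak gradient `du`: a function on the
perforated plane, `1`-periodic in both variables, with weak partial derivatives `du 0`, `du 1`,
all of them square integrable over the cell. Equalities of values are meant almost everywhere. -/
structure MemH1per (G : Set Plane) (u : Plane → ℝ) (du : Fin 2 → Plane → ℝ) : Prop where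
  periodic : ∀ k : Fin 2 → ℤ,
    ∀ᵐ ξ ∂(volume.restrict (perforatedPlane G)), u (ξ + lattice k) = u ξ
  memLp : MemLp u 2 (volume.restrict (cell G))
  memLp_grad : ∀ i, MemLp (du i) 2 (volume.restrict (cell G))
  weak_grad : ∀ i, HasWeakPartial (perforatedPlane G) u (du i) i

/-- `u ∈ H¹_per(Y)`, with weak gradient `du`, is a weak solution of the periodic Neumann problem
`Δu = F₀ + ∂₁F₁ + ∂₂F₂` in `Y`, `∂_ν u = F₁ν₁ + F₂ν₂` on the boundary of the holes, `⟨u⟩_Y = 0`: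
the equation is multiplied by a test function `φ ∈ H¹_per(Y)` and integrated by parts, where the
boundary integrals over the holes cancel by the Neumann condition and those over the sides of the
square cancel by periodicity. -/
structure IsWeakSolution (G : Set Plane) (F₀ : Plane → ℝ) (F : Fin 2 → Plane → ℝ)
    (u : Plane → ℝ) (du : Fin 2 → Plane → ℝ) : Prop where
  mem : MemH1per G u du
  equation : ∀ (φ : Plane → ℝ) (dφ : Fin 2 → Plane → ℝ), MemH1per G φ dφ →
    -∫ ξ in cell G, ∑ i, du i ξ * dφ i ξ =
      (∫ ξ in cell G, F₀ ξ * φ ξ) - ∫ ξ in cell G, ∑ i, F i ξ * dφ i ξ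
  mean_zero : ⨍ ξ in cell G, u ξ = 0

/-- The term `F₀` of the problem for the corrector `N_α`: it is `0` if `|α| = 1`, and
`h_α - δ_{α₁α₂} N_{α₃…α_k} - ∂_{α₁} N_{α₂…α_k}` if `|α| ≥ 2`. -/
def source (N : List (Fin 2) → Plane → ℝ) (DN : List (Fin 2) → Fin 2 → Plane → ℝ)
    (h : List (Fin 2) → ℝ) : List (Fin 2) → Plane → ℝ
  | [] => fun _ => 0
  | [_] => fun _ => 0
  | a :: b :: γ => fun ξ => h (a :: b :: γ) - (if a = b then N γ ξ else 0) - DN (b :: γ) a ξ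

/-- The term `(F₁, F₂)` of the problem for the corrector `N_α`, namely
`F_i = -δ_{i α₁} N_{α₂…α_k}`. -/
def flux (N : List (Fin 2) → Plane → ℝ) : List (Fin 2) → Fin 2 → Plane → ℝ
  | [] => fun _ _ => 0
  | a :: β => fun i ξ => if i = a then -N β ξ else 0

/-- `N` is a family of cell correctors, indexed by the words `α` in the two letters, with weak
gradients `DN`, and `h` is the corresponding family of constants: `N_∅ = 1`, and `N_α` solves
* for `α = (a)`: `ΔN_α = 0` in `Y`, `∂_ν N_α = -ν_a` on the holes, `⟨N_α⟩_Y = 0`;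
* for `|α| ≥ 2`: `ΔN_α = h_α - δ_{α₁α₂} N_{α₃…α_k} - 2 ∂_{α₁} N_{α₂…α_k}` in `Y`,
  `∂_ν N_α = -ν_{α₁} N_{α₂…α_k}` on the holes, `⟨N_α⟩_Y = 0`.
One of the two copies of `-∂_{α₁} N_{α₂…α_k}` is in `source`, the other is the divergence of
`flux`. The values of `h` at words of length less than two do not matter. -/
structure IsCellCorrectors (G : Set Plane) (N : List (Fin 2) → Plane → ℝ)
    (DN : List (Fin 2) → Fin 2 → Plane → ℝ) (h : List (Fin 2) → ℝ) : Prop where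
  empty : ∀ ξ, N [] ξ = 1
  solves : ∀ α : List (Fin 2), 1 ≤ α.length →
    IsWeakSolution G (source N DN h α) (flux N α) (N α) (DN α)

end CellProblem

end

/-!
Let `R` be the reflection in the line `ξ_l = 1/2`; it preserves the cell and differs from `S_l` by a
period. By induction on the word `α`, the function `(-1)^(δ_{α₁l} + … + δ_{α_kl}) N_α ∘ R` solves
the same cell problem as `N_α`. The constant `h_α` does not spoil this: testing the equation with
`1` makes `h_α` the mean over the cell of terms with the parity of `α`, so that `h_α = 0` when that
parity is odd. Weak solutions of mean zero are unique: the difference of two of them has zero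
weak gradient, so by mollification it is locally constant, hence constant on the connected cell.
-/

namespace CellProblem

open Filter Set

/-! ### Functions that are locally constant almost everywhere -/

section LocallyConstant

variable {X β : Type*} [TopologicalSpace X] [MeasurableSpace X] {μ : Measure X} {f : X → β} {x : X}

lemma eventually_nhds_inf_ae_iff {p : X → Prop} :
    (∀ᶠ y in 𝓝 x ⊓ ae μ, p y) ↔ ∃ V, IsOpen V ∧ x ∈ V ∧ ∀ᵐ y ∂μ, y ∈ V → p y := by
  rw [((nhds_basis_opens x).inf (ae μ).basis_sets).eventually_iff]
  constructor
  · rintro ⟨⟨V, t⟩, ⟨⟨hxV, hV⟩, ht⟩, h⟩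
    exact ⟨V, hV, hxV, mem_of_superset ht fun y hy hyV => h ⟨hyV, hy⟩⟩
  · rintro ⟨V, hV, hxV, h⟩
    exact ⟨⟨V, _⟩, ⟨⟨hxV, hV⟩, h⟩, fun y hy => hy.2 hy.1⟩

lemma neBot_nhds_inf_ae [μ.IsOpenPosMeasure] : (𝓝 x ⊓ ae μ).NeBot := by
  rw [← frequently_true_iff_neBot, Filter.Frequently, eventually_nhds_inf_ae_iff]
  rintro ⟨V, hV, hxV, h⟩
  exact hV.measure_ne_zero μ ⟨x, hxV⟩ (measure_eq_zero_iff_ae_notMem.2 (by simpa using h))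

theorem exists_ae_eq_const_of_isConnected [SecondCountableTopology X] [μ.IsOpenPosMeasure]
    {S : Set X} (hS : IsConnected S) (h : ∀ x ∈ S, ∃ c, ∀ᶠ y in 𝓝 x ⊓ ae μ, f y = c) :
    ∃ c, ∀ᵐ y ∂μ, y ∈ S → f y = c := by
  choose c hc using fun x : S => h x x.2
  have c_locallyConstant : IsLocallyConstant c := by
    refine (IsLocallyConstant.iff_exists_open c).2 fun x => ?_
    obtain ⟨V, hV, hxV, hfV⟩ := eventually_nhds_inf_ae_iff.1 (hc x)
    refine ⟨_, hV.preimage continuous_subtype_val, hxV, fun y hy => ?_⟩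
    have := neBot_nhds_inf_ae (μ := μ) (x := (y : X))
    obtain ⟨z, hzy, hzx⟩ :=
      ((hc y).and (eventually_nhds_inf_ae_iff.2 ⟨V, hV, hy, hfV⟩)).exists
    exact hzy.symm.trans hzx
  have := isConnected_iff_connectedSpace.1 hS
  obtain ⟨x₀⟩ : Nonempty S := inferInstance
  refine ⟨c x₀, ae_iff.2 (measure_null_of_locally_null _ fun x hx => ?_)⟩
  obtain ⟨hxS, -⟩ := Classical.not_imp.1 hx
  obtain ⟨V, hV, hxV, hfV⟩ := eventually_nhds_inf_ae_iff.1 (hc ⟨x, hxS⟩)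
  rw [c_locallyConstant.apply_eq_of_preconnectedSpace ⟨x, hxS⟩ x₀] at hfV
  refine ⟨_, inter_mem_nhdsWithin _ (hV.mem_nhds hxV), measure_mono_null ?_ (ae_iff.1 hfV)⟩
  rintro y ⟨hy, hyV⟩ hfy
  exact hy fun _ => hfy hyV

theorem eqOn_closure_of_ae_eq {U : Set X} {g : X → β} [TopologicalSpace β] [T2Space β]
    [μ.IsOpenPosMeasure] (hU : IsOpen U) (hfg : f =ᵐ[μ.restrict U] g)
    (hf : ContinuousOn f (closure U)) (hg : ContinuousOn g (closure U)) :
    EqOn f g (closure U) :=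
  (Measure.eqOn_open_of_ae_eq hfg hU (hf.mono subset_closure)
    (hg.mono subset_closure)).of_subset_closure hf hg subset_closure subset_rfl

end LocallyConstant

/-! ### Affine isometries and test functions -/

lemma measurePreserving_affineIsometryEquiv {V : Type*} [NormedAddCommGroup V]
    [InnerProductSpace ℝ V] [FiniteDimensional ℝ V] [MeasurableSpace V] [BorelSpace V]
    (T : V ≃ᵃⁱ[ℝ] V) : MeasurePreserving T volume volume := by
  have hT : (T : V → V) = (· + T 0) ∘ T.linearIsometryEquiv := by
    funext ξ
    simpa using T.map_vadd 0 ξ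
  rw [hT]
  exact (measurePreserving_add_right volume _).comp T.linearIsometryEquiv.measurePreserving

/-- `ψ` is a smooth compactly supported test function on `U`. This names the conditions which
`HasWeakPartial` spells out for its test functions. -/
structure IsTestFunction {E : Type*} [NormedAddCommGroup E] [NormedSpace ℝ E] (U : Set E)
    (ψ : E → ℝ) : Prop where
  contDiff : ContDiff ℝ ∞ ψ
  hasCompactSupport : HasCompactSupport ψ
  tsupport_subset : tsupport ψ ⊆ U

namespace IsTestFunction

variable {E : Type*} [NormedAddCommGroup E] [NormedSpace ℝ E] {U : Set E} {ψ : E → ℝ}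

lemma fderiv_apply (hψ : IsTestFunction U ψ) (v : E) :
    IsTestFunction U fun ξ => fderiv ℝ ψ ξ v where
  contDiff := (hψ.contDiff.fderiv_right le_rfl).clm_apply contDiff_const
  hasCompactSupport := hψ.hasCompactSupport.fderiv_apply (𝕜 := ℝ) v
  tsupport_subset := (tsupport_fderiv_apply_subset ℝ v).trans hψ.tsupport_subset

lemma comp_affineIsometryEquiv {E' : Type*} [NormedAddCommGroup E'] [NormedSpace ℝ E']
    (hψ : IsTestFunction U ψ) (T : E' ≃ᵃⁱ[ℝ] E) : IsTestFunction (T ⁻¹' U) (ψ ∘ T) where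
  contDiff := hψ.contDiff.comp T.toAffineIsometry.toContinuousAffineMap.contDiff
  hasCompactSupport := hψ.hasCompactSupport.comp_homeomorph T.toHomeomorph
  tsupport_subset := (tsupport_comp_eq_preimage ψ T.toHomeomorph).subset.trans
    (preimage_mono hψ.tsupport_subset)

lemma fderiv_comp_affineIsometryEquiv {E' : Type*} [NormedAddCommGroup E'] [NormedSpace ℝ E']
    (hψ : IsTestFunction U ψ) (T : E' ≃ᵃⁱ[ℝ] E) (ξ v : E') :
    fderiv ℝ (ψ ∘ T) ξ v = fderiv ℝ ψ (T ξ) (T.linearIsometryEquiv v) := by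
  have hψ' := (hψ.contDiff.differentiable (by simp) (T ξ)).hasFDerivAt
  have hT := T.toAffineIsometry.toContinuousAffineMap.hasFDerivAt (x := ξ)
  rw [(hψ'.comp ξ hT).fderiv]
  rfl

variable [MeasurableSpace E] {μ : Measure E} {f : E → ℝ}

lemma setIntegral_mul (hψ : IsTestFunction U ψ) :
    ∫ ξ in U, f ξ * ψ ξ ∂μ = ∫ ξ, f ξ * ψ ξ ∂μ :=
  setIntegral_eq_integral_of_forall_compl_eq_zero fun ξ hξ => by
    rw [image_eq_zero_of_notMem_tsupport fun h => hξ (hψ.tsupport_subset h), mul_zero]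

lemma integrable_mul [OpensMeasurableSpace E] (hψ : IsTestFunction U ψ)
    (hf : LocallyIntegrableOn f U μ) : Integrable (fun ξ => f ξ * ψ ξ) μ :=
  (integrableOn_iff_integrable_of_support_subset
    ((Function.support_mul_subset_right _ _).trans (subset_tsupport ψ))).1
    ((hf.integrableOn_compact_subset hψ.tsupport_subset hψ.hasCompactSupport).mul_continuousOn
      hψ.contDiff.continuous.continuousOn hψ.hasCompactSupport)

end IsTestFunction

/-! ### Functions with vanishing weak gradient -/

section VanishingGradient

variable {E F : Type*} [NormedAddCommGroup E] [NormedSpace ℝ E] [MeasurableSpace E]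
  [NormedAddCommGroup F] [NormedSpace ℝ F] {μ : Measure E} {U : Set E} {f : E → F}

/-- The gradient of `f` on `U` in the sense of distributions is zero. -/
def HasWeakGradientZero (μ : Measure E) (U : Set E) (f : E → F) : Prop :=
  ∀ ψ : E → ℝ, IsTestFunction U ψ → ∀ v : E, ∫ ξ, fderiv ℝ ψ ξ v • f ξ ∂μ = 0

lemma HasWeakGradientZero.indicator (hf : HasWeakGradientZero μ U f) {V K : Set E}
    (hVK : V ⊆ K) (hVU : V ⊆ U) : HasWeakGradientZero μ V (K.indicator f) := by
  intro ψ hψ v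
  rw [← hf ψ ⟨hψ.contDiff, hψ.hasCompactSupport, hψ.tsupport_subset.trans hVU⟩ v]
  congr 1 with ξ
  by_cases hξ : ξ ∈ K
  · rw [indicator_of_mem hξ]
  · have hψξ : ξ ∉ tsupport fun ξ => fderiv ℝ ψ ξ v := fun h =>
      hξ (hVK ((hψ.fderiv_apply v).tsupport_subset h))
    rw [image_eq_zero_of_notMem_tsupport hψξ, zero_smul, zero_smul]

variable [FiniteDimensional ℝ E] [BorelSpace E] [μ.IsAddHaarMeasure]

open scoped Convolution in
lemma HasWeakGradientZero.hasFDerivAt_convolution (hf : HasWeakGradientZero μ U f)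
    (hfi : LocallyIntegrable f μ) {φ : E → ℝ} (hφ : ContDiff ℝ ∞ φ)
    (hφc : HasCompactSupport φ) {y : E} (hy : ∀ t ∈ tsupport φ, y - t ∈ U) :
    HasFDerivAt (φ ⋆[ContinuousLinearMap.lsmul ℝ ℝ, μ] f) (0 : E →L[ℝ] F) y := by
  let T : E ≃ᵃⁱ[ℝ] E := AffineIsometryEquiv.constVSub ℝ y
  have hφT : IsTestFunction U (φ ∘ T) :=
    have h := IsTestFunction.comp_affineIsometryEquiv ⟨hφ, hφc, subset_rfl⟩ T
    ⟨h.contDiff, h.hasCompactSupport, h.tsupport_subset.trans fun t ht => by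
      simpa [T] using hy (T t) ht⟩
  have hint := ((hφc.fderiv ℝ).convolutionExists_left
    ((ContinuousLinearMap.lsmul ℝ ℝ).precompL E) (hφ.continuous_fderiv (by simp)) hfi
    y).integrable_swap
  convert hφc.hasFDerivAt_convolution_left (ContinuousLinearMap.lsmul ℝ ℝ)
    (hφ.of_le (by simp)) hfi y using 1
  ext v
  rw [convolution_eq_swap, ContinuousLinearMap.integral_apply hint,
    zero_apply, ← neg_eq_zero.2 (hf _ hφT v), ← integral_neg]
  congr 1 with t
  have T_linear : T.linearIsometryEquiv v = -v := rfl
  rw [IsTestFunction.fderiv_comp_affineIsometryEquiv ⟨hφ, hφc, subset_rfl⟩, T_linear]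
  simp [T, ContinuousLinearMap.precompL_apply]

/-- Mollification of a function with vanishing gradient: the mollified functions are constant near
`x`, and they converge almost everywhere. -/
theorem HasWeakGradientZero.exists_eventually_eq_const_of_locallyIntegrable [CompleteSpace F]
    (hf : HasWeakGradientZero μ U f) (hfi : LocallyIntegrable f μ) (hU : IsOpen U) {x : E}
    (hx : x ∈ U) : ∃ c, ∀ᶠ ξ in 𝓝 x ⊓ ae μ, f ξ = c := by
  obtain ⟨ε, hε, hεU⟩ := Metric.isOpen_iff.1 hU x hx
  obtain ⟨r, hr, hrε⟩ : ∃ r > 0, 2 * r = ε := ⟨ε / 2, by positivity, by ring⟩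
  let φ (n : ℕ) : ContDiffBump (0 : E) :=
    { rIn := r / (2 * (n + 1))
      rOut := r / (n + 1)
      rIn_pos := by positivity
      rIn_lt_rOut := div_lt_div_of_pos_left hr (by positivity) (by linarith) }
  let Γ (n : ℕ) : E → F := convolution ((φ n).normed μ) f (ContinuousLinearMap.lsmul ℝ ℝ) μ
  have Γ_tendsto : ∀ᵐ ξ ∂μ, Tendsto (fun n => Γ n ξ) atTop (𝓝 (f ξ)) := by
    refine ContDiffBump.ae_convolution_tendsto_right_of_locallyIntegrable (K := 2) ?_
      (Eventually.of_forall fun n => le_of_eq ?_) hfi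
    · simpa [φ, div_eq_mul_inv] using
        (tendsto_one_div_add_atTop_nhds_zero_nat (𝕜 := ℝ)).const_mul r
    · simp only [φ]
      field_simp
  have Γ_hasFDerivAt (n : ℕ) {y : E} (hy : y ∈ Metric.ball x r) :
      HasFDerivAt (Γ n) (0 : E →L[ℝ] F) y := by
    refine hf.hasFDerivAt_convolution hfi (φ n).contDiff_normed (φ n).hasCompactSupport_normed
      fun t ht => hεU ?_
    rw [(φ n).tsupport_normed_eq, mem_closedBall_zero_iff] at ht
    have hφr : (φ n).rOut ≤ r := div_le_self hr.le (by simp)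
    rw [mem_ball_iff_norm] at hy ⊢
    calc ‖y - t - x‖ = ‖y - x - t‖ := by rw [sub_right_comm]
      _ ≤ ‖y - x‖ + ‖t‖ := norm_sub_le _ _
      _ < ε := by linarith
  have Γ_const (n : ℕ) {y : E} (hy : y ∈ Metric.ball x r) : Γ n y = Γ n x :=
    Metric.isOpen_ball.is_const_of_fderiv_eq_zero (𝕜 := ℝ) (convex_ball x r).isPreconnected
      (fun z hz => (Γ_hasFDerivAt n hz).differentiableAt.differentiableWithinAt)
      (fun z hz => (Γ_hasFDerivAt n hz).fderiv) hy (Metric.mem_ball_self hr)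
  refine ⟨limUnder atTop fun n => Γ n x, eventually_nhds_inf_ae_iff.2
    ⟨Metric.ball x r, Metric.isOpen_ball, Metric.mem_ball_self hr, ?_⟩⟩
  filter_upwards [Γ_tendsto] with ξ hξ hξr
  simp only [Γ_const _ hξr] at hξ
  exact hξ.limUnder_eq.symm

theorem HasWeakGradientZero.exists_eventually_eq_const [CompleteSpace F]
    (hf : HasWeakGradientZero μ U f) (hfi : LocallyIntegrableOn f U μ) (hU : IsOpen U) {x : E}
    (hx : x ∈ U) : ∃ c, ∀ᶠ ξ in 𝓝 x ⊓ ae μ, f ξ = c := by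
  obtain ⟨r, hr, hrU⟩ := Metric.nhds_basis_closedBall.mem_iff.1 (hU.mem_nhds hx)
  have hBK : Metric.ball x r ⊆ Metric.closedBall x r := Metric.ball_subset_closedBall
  have hfK : Integrable ((Metric.closedBall x r).indicator f) μ :=
    (integrable_indicator_iff Metric.isClosed_closedBall.measurableSet).2
      (hfi.integrableOn_compact_subset hrU (isCompact_closedBall x r))
  obtain ⟨c, hc⟩ := (hf.indicator hBK
    (hBK.trans hrU)).exists_eventually_eq_const_of_locallyIntegrable hfK.locallyIntegrable
      Metric.isOpen_ball (Metric.mem_ball_self hr)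
  refine ⟨c, ?_⟩
  filter_upwards [hc, mem_inf_of_left (Metric.ball_mem_nhds x hr)] with ξ hξ hξr
  rwa [indicator_of_mem (hBK hξr)] at hξ

end VanishingGradient

/-! ### Weak partial derivatives -/

lemma locallyIntegrableOn_comp_homeomorph {X Y F : Type*} [TopologicalSpace X] [MeasurableSpace X]
    [BorelSpace X] [TopologicalSpace Y] [MeasurableSpace Y] [BorelSpace Y] [NormedAddCommGroup F]
    {μ : Measure X} {ν : Measure Y} {U : Set Y} {f : Y → F} (hf : LocallyIntegrableOn f U ν)
    (T : X ≃ₜ Y) (hT : MeasurePreserving T μ ν) : LocallyIntegrableOn (f ∘ T) (T ⁻¹' U) μ := by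
  intro x hx
  obtain ⟨s, hs, hfs⟩ := hf (T x) hx
  exact ⟨T ⁻¹' s, T.continuous.continuousWithinAt.tendsto_nhdsWithin (mapsTo_preimage T U) hs,
    (hT.integrableOn_comp_preimage T.measurableEmbedding).2 hfs⟩

namespace HasWeakPartial

variable {U : Set Plane} {f g f' g' ψ : Plane → ℝ} {i : Fin 2}

lemma integral_mul_fderiv (h : HasWeakPartial U f g i) (hψ : IsTestFunction U ψ) :
    ∫ ξ in U, f ξ * fderiv ℝ ψ ξ (EuclideanSpace.single i 1) = -∫ ξ in U, g ξ * ψ ξ :=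
  h.2.2 ψ hψ.contDiff hψ.hasCompactSupport hψ.tsupport_subset

lemma const (U : Set Plane) (c : ℝ) (i : Fin 2) :
    HasWeakPartial U (fun _ => c) (fun _ => 0) i := by
  refine ⟨(locallyIntegrable_const c).locallyIntegrableOn U,
    (locallyIntegrable_const 0).locallyIntegrableOn U, fun ψ hψ hψc hψU => ?_⟩
  have hψt : IsTestFunction U ψ := ⟨hψ, hψc, hψU⟩
  have hc : LocallyIntegrableOn (fun _ : Plane => c) U :=
    (locallyIntegrable_const c).locallyIntegrableOn U
  rw [(hψt.fderiv_apply _).setIntegral_mul,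
    integral_mul_fderiv_eq_neg_fderiv_mul_of_integrable (by simp)
      ((hψt.fderiv_apply _).integrable_mul hc) (hψt.integrable_mul hc) (by fun_prop)
      fun ξ _ => hψ.differentiable (by simp) ξ]
  simp

lemma sub (h : HasWeakPartial U f g i) (h' : HasWeakPartial U f' g' i) :
    HasWeakPartial U (fun ξ => f ξ - f' ξ) (fun ξ => g ξ - g' ξ) i := by
  refine ⟨h.1.sub h'.1, h.2.1.sub h'.2.1, fun ψ hψ hψc hψU => ?_⟩
  have hψt : IsTestFunction U ψ := ⟨hψ, hψc, hψU⟩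
  have hψi := hψt.fderiv_apply (EuclideanSpace.single i 1)
  simp only [sub_mul]
  rw [integral_sub (hψi.integrable_mul h.1).restrict (hψi.integrable_mul h'.1).restrict,
    integral_sub (hψt.integrable_mul h.2.1).restrict (hψt.integrable_mul h'.2.1).restrict,
    h.integral_mul_fderiv hψt, h'.integral_mul_fderiv hψt]
  ring

lemma const_mul (h : HasWeakPartial U f g i) (c : ℝ) :
    HasWeakPartial U (fun ξ => c * f ξ) (fun ξ => c * g ξ) i := by
  refine ⟨h.1.smul c, h.2.1.smul c, fun ψ hψ hψc hψU => ?_⟩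
  simp only [mul_assoc]
  rw [integral_const_mul, integral_const_mul, h.integral_mul_fderiv ⟨hψ, hψc, hψU⟩, mul_neg]

lemma comp_affineIsometryEquiv (h : HasWeakPartial U f g i) (T : Plane ≃ᵃⁱ[ℝ] Plane) {σ : ℝ}
    (hT : T.linearIsometryEquiv (EuclideanSpace.single i 1) =
      σ • (EuclideanSpace.single i 1 : Plane)) :
    HasWeakPartial (T ⁻¹' U) (fun ξ => f (T ξ)) (fun ξ => σ * g (T ξ)) i := by
  have T_preserving := measurePreserving_affineIsometryEquiv T
  refine ⟨locallyIntegrableOn_comp_homeomorph h.1 T.toHomeomorph T_preserving,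
    (locallyIntegrableOn_comp_homeomorph h.2.1 T.toHomeomorph T_preserving).smul σ,
    fun ψ hψ hψc hψU => ?_⟩
  have change_var (p : Plane → ℝ) : ∫ ξ in T ⁻¹' U, p (T ξ) = ∫ ξ in U, p ξ :=
    T_preserving.setIntegral_preimage_emb T.toHomeomorph.measurableEmbedding p U
  obtain ⟨ρ, hρ, rfl⟩ : ∃ ρ, IsTestFunction U ρ ∧ ρ ∘ T = ψ := by
    refine ⟨ψ ∘ T.symm, ?_, by ext; simp⟩
    have hρ := IsTestFunction.comp_affineIsometryEquiv ⟨hψ, hψc, hψU⟩ T.symm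
    rwa [← preimage_comp, show T ∘ T.symm = id from funext T.apply_symm_apply,
      preimage_id] at hρ
  calc ∫ ξ in T ⁻¹' U, f (T ξ) * fderiv ℝ (ρ ∘ T) ξ (EuclideanSpace.single i 1)
      = ∫ ξ in T ⁻¹' U, σ * (f (T ξ) * fderiv ℝ ρ (T ξ) (EuclideanSpace.single i 1)) := by
        simp only [hρ.fderiv_comp_affineIsometryEquiv, hT, map_smul, smul_eq_mul, mul_left_comm]
    _ = σ * ∫ ξ in U, f ξ * fderiv ℝ ρ ξ (EuclideanSpace.single i 1) := by
        rw [integral_const_mul,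
          change_var fun ξ => f ξ * fderiv ℝ ρ ξ (EuclideanSpace.single i 1)]
    _ = -(σ * ∫ ξ in T ⁻¹' U, g (T ξ) * ρ (T ξ)) := by
        rw [h.integral_mul_fderiv hρ, mul_neg, change_var fun ξ => g ξ * ρ ξ]
    _ = -∫ ξ in T ⁻¹' U, σ * g (T ξ) * (ρ ∘ T) ξ := by
        simp only [← integral_const_mul, mul_assoc, Function.comp_apply]

theorem ae_unique (h : HasWeakPartial U f g i) (h' : HasWeakPartial U f' g' i) (hU : IsOpen U)
    (hff' : f =ᵐ[volume.restrict U] f') : g =ᵐ[volume.restrict U] g' := by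
  have hd := h.sub h'
  have hsub : ∀ᵐ ξ, ξ ∈ U → g ξ - g' ξ = 0 := by
    refine hU.ae_eq_zero_of_integral_contDiff_smul_eq_zero hd.2.1 fun ψ hψ hψc hψU => ?_
    have hψt : IsTestFunction U ψ := ⟨hψ, hψc, hψU⟩
    have hleft : ∫ ξ in U, (f ξ - f' ξ) * fderiv ℝ ψ ξ (EuclideanSpace.single i 1) = 0 :=
      integral_eq_zero_of_ae (by filter_upwards [hff'] with ξ hξ; simp [hξ])
    rw [hd.integral_mul_fderiv hψt, neg_eq_zero, hψt.setIntegral_mul] at hleft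
    simpa only [smul_eq_mul, mul_comm (ψ _)] using hleft
  exact (ae_restrict_iff' hU.measurableSet).2
    (hsub.mono fun ξ hξ hξU => sub_eq_zero.1 (hξ hξU))

end HasWeakPartial

theorem hasWeakGradientZero_of_hasWeakPartial {U : Set Plane} {f : Plane → ℝ}
    {g : Fin 2 → Plane → ℝ} (h : ∀ i, HasWeakPartial U f (g i) i)
    (hg : ∀ i, g i =ᵐ[volume.restrict U] 0) : HasWeakGradientZero volume U f := by
  intro ψ hψ v
  have partial_eq_zero (i : Fin 2) :
      ∫ ξ, f ξ * fderiv ℝ ψ ξ (EuclideanSpace.single i 1) = 0 := by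
    rw [← (hψ.fderiv_apply _).setIntegral_mul, (h i).integral_mul_fderiv hψ, neg_eq_zero]
    exact integral_eq_zero_of_ae (by filter_upwards [hg i] with ξ hξ; simp [hξ])
  have hv : v = ∑ i, v i • EuclideanSpace.single i (1 : ℝ) := by
    simpa using ((EuclideanSpace.basisFun (Fin 2) ℝ).sum_repr v).symm
  calc ∫ ξ, fderiv ℝ ψ ξ v • f ξ
      = ∫ ξ, ∑ i, v i * (f ξ * fderiv ℝ ψ ξ (EuclideanSpace.single i 1)) := by
        congr 1 with ξ
        conv_lhs => rw [hv]
        simp only [map_sum, map_smul, smul_eq_mul, Finset.sum_mul]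
        exact Finset.sum_congr rfl fun i _ => by ring
    _ = 0 := by
        rw [integral_finsetSum _ fun i _ =>
          ((hψ.fderiv_apply _).integrable_mul (h i).1).const_mul _]
        simp only [integral_const_mul, partial_eq_zero, mul_zero, Finset.sum_const_zero]

/-! ### The perforated plane and its symmetries -/

lemma lattice_apply (k : Fin 2 → ℤ) (i : Fin 2) : lattice k i = k i := rfl

lemma lattice_zero : lattice 0 = 0 := by
  ext i; simp [lattice]

lemma lattice_add (k m : Fin 2 → ℤ) : lattice (k + m) = lattice k + lattice m := by
  ext i; simp [lattice]

lemma lattice_neg (k : Fin 2 → ℤ) : lattice (-k) = -lattice k := by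
  ext i; simp [lattice]

lemma lattice_sub (k m : Fin 2 → ℤ) : lattice (k - m) = lattice k - lattice m := by
  ext i; simp [lattice]

lemma isClosed_range_lattice : IsClosed (range lattice) := by
  have range_eq :
      range lattice = ⋂ i : Fin 2, (fun ξ : Plane => ξ i) ⁻¹' range ((↑) : ℤ → ℝ) := by
    ext ξ
    simp only [mem_range, mem_iInter, mem_preimage]
    refine ⟨fun ⟨k, hk⟩ i => ⟨k i, by rw [← hk, lattice_apply]⟩, fun h => ?_⟩
    choose k hk using h
    exact ⟨k, by ext i; exact hk i⟩
  rw [range_eq]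
  exact isClosed_iInter fun i => Int.isClosedEmbedding_coe_real.isClosed_range.preimage
    (by fun_prop)

lemma isCompact_closedSquare : IsCompact closedSquare := by
  have closedSquare_eq :
      closedSquare = EuclideanSpace.equiv (Fin 2) ℝ ⁻¹' univ.pi fun _ => Icc 0 1 := by
    ext ξ
    simp only [closedSquare, mem_ofPred_eq, mem_preimage, mem_univ_pi, mem_Icc]
    rfl
  rw [closedSquare_eq]
  exact (EuclideanSpace.equiv (Fin 2) ℝ).toHomeomorph.isCompact_preimage.2
    (isCompact_univ_pi fun _ => isCompact_Icc)

lemma openSquare_subset_closedSquare : openSquare ⊆ closedSquare :=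
  fun _ h i => ⟨(h i).1.le, (h i).2.le⟩

lemma eq_of_sub_lattice_mem {ξ : Plane} {k m : Fin 2 → ℤ}
    (hk : ξ - lattice k ∈ openSquare) (hm : ξ - lattice m ∈ closedSquare) : k = m := by
  funext i
  obtain ⟨hk0, hk1⟩ := hk i
  obtain ⟨hm0, hm1⟩ := hm i
  simp only [PiLp.sub_apply, lattice_apply] at hk0 hk1 hm0 hm1
  have hkm : k i < m i + 1 := by exact_mod_cast (by linarith : (k i : ℝ) < m i + 1)
  have hmk : m i < k i + 1 := by exact_mod_cast (by linarith : (m i : ℝ) < k i + 1)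
  omega

lemma exists_sub_lattice_mem_closedSquare (ξ : Plane) :
    ∃ k : Fin 2 → ℤ, ξ - lattice k ∈ closedSquare := by
  refine ⟨fun i => ⌊ξ i⌋, fun i => ?_⟩
  simp only [PiLp.sub_apply, lattice_apply]
  constructor <;> linarith [Int.floor_le (ξ i), Int.lt_floor_add_one (ξ i)]

section PerforatedPlane

variable {G : Set Plane}

lemma measurableSet_cell (G : Set Plane) : MeasurableSet (cell G) :=
  isCompact_closedSquare.measurableSet.diff isClosed_closure.measurableSet

instance isFiniteMeasure_restrict_cell (G : Set Plane) :
    IsFiniteMeasure (volume.restrict (cell G)) :=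
  isFiniteMeasure_restrict.2
    ((measure_mono sdiff_subset).trans_lt isCompact_closedSquare.measure_lt_top).ne

lemma cell_subset_perforatedPlane (G : Set Plane) : cell G ⊆ perforatedPlane G :=
  fun ξ hξ => ⟨0, by rwa [lattice_zero, sub_zero]⟩

lemma mem_perforatedPlane_iff (hG : closure G ⊆ openSquare) {ξ : Plane} :
    ξ ∈ perforatedPlane G ↔ ∀ k, ξ - lattice k ∉ closure G := by
  refine ⟨fun ⟨m, hm⟩ k hk => ?_, fun h => ?_⟩
  · obtain rfl := eq_of_sub_lattice_mem (hG hk) hm.1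
    exact hm.2 hk
  · obtain ⟨k, hk⟩ := exists_sub_lattice_mem_closedSquare ξ
    exact ⟨k, hk, h k⟩

open scoped Pointwise in
lemma isOpen_perforatedPlane (hG : closure G ⊆ openSquare) : IsOpen (perforatedPlane G) := by
  have hc : IsCompact (closure G) := isCompact_closedSquare.of_isClosed_subset isClosed_closure
    (hG.trans openSquare_subset_closedSquare)
  have compl_eq : (perforatedPlane G)ᶜ = closure G + range lattice := by
    ext ξ
    rw [mem_compl_iff, mem_perforatedPlane_iff hG, Set.mem_add]
    push Not
    refine ⟨fun ⟨k, hk⟩ => ⟨_, hk, _, ⟨k, rfl⟩, sub_add_cancel _ _⟩, ?_⟩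
    rintro ⟨x, hx, _, ⟨k, rfl⟩, rfl⟩
    exact ⟨k, by rwa [add_sub_cancel_right]⟩
  rw [← isClosed_compl_iff, compl_eq]
  exact isClosed_range_lattice.add_left_of_isCompact hc

lemma preimage_add_lattice_perforatedPlane (k : Fin 2 → ℤ) :
    (· + lattice k) ⁻¹' perforatedPlane G = perforatedPlane G := by
  ext ξ
  constructor
  · rintro ⟨m, hm⟩
    exact ⟨m - k, by rwa [lattice_sub, sub_sub_eq_add_sub]⟩
  · rintro ⟨m, hm⟩
    exact ⟨m + k, by rwa [lattice_add, add_sub_add_right_eq_sub]⟩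

theorem ae_perforatedPlane_of_ae_cell {p : Plane → Prop}
    (hper : ∀ k, ∀ᵐ ξ ∂volume.restrict (perforatedPlane G), p (ξ + lattice k) → p ξ)
    (h : ∀ᵐ ξ ∂volume.restrict (cell G), p ξ) :
    ∀ᵐ ξ ∂volume.restrict (perforatedPlane G), p ξ := by
  have perforatedPlane_eq :
      perforatedPlane G = ⋃ k : Fin 2 → ℤ, (· + lattice (-k)) ⁻¹' cell G := by
    ext ξ
    simp [perforatedPlane, lattice_neg, sub_eq_add_neg]
  have h_piece (k : Fin 2 → ℤ) :
      ∀ᵐ ξ ∂volume.restrict ((· + lattice (-k)) ⁻¹' cell G), p (ξ + lattice (-k)) :=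
    ((measurePreserving_add_right volume (lattice (-k))).restrict_preimage
      (measurableSet_cell G)).quasiMeasurePreserving.ae h
  rw [perforatedPlane_eq] at hper ⊢
  refine (ae_restrict_iUnion_iff _ _).2 fun k => ?_
  filter_upwards [h_piece k, (ae_restrict_iUnion_iff _ _).1 (hper (-k)) k] with ξ hξ hξp
  exact hξp hξ

lemma volume_cell_ne_zero (hG : closure G ⊆ openSquare) : volume (cell G) ≠ 0 := by
  intro hvol
  have h_ae_false : ∀ᵐ _ ∂volume.restrict (perforatedPlane G), False :=
    ae_perforatedPlane_of_ae_cell (by simp) (by simp [Measure.restrict_eq_zero.2 hvol])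
  rw [eventually_false_iff_eq_bot, ae_eq_bot, Measure.restrict_eq_zero,
    (isOpen_perforatedPlane hG).measure_eq_zero_iff volume] at h_ae_false
  have zero_mem : (0 : Plane) ∈ cell G :=
    ⟨fun i => by simp, fun h0 => absurd (hG h0 0).1 (by simp)⟩
  exact h_ae_false.subset (cell_subset_perforatedPlane G zero_mem)

lemma measureReal_cell_ne_zero (hG : closure G ⊆ openSquare) : volume.real (cell G) ≠ 0 :=
  ENNReal.toReal_ne_zero.2
    ⟨volume_cell_ne_zero hG, isFiniteMeasure_restrict.1 (isFiniteMeasure_restrict_cell G)⟩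

end PerforatedPlane

section Mirror

variable {G A : Set Plane} {l : Fin 2}

lemma mirror_mirror (l : Fin 2) (ξ : Plane) : mirror l (mirror l ξ) = ξ := by
  ext i; by_cases h : i = l <;> simp [mirror, h]

lemma mirror_add_lattice (l : Fin 2) (ξ : Plane) (k : Fin 2 → ℤ) :
    mirror l (ξ + lattice k) = mirror l ξ + lattice (fun i => if i = l then -k i else k i) := by
  ext i; by_cases h : i = l <;> simp [mirror, lattice_apply, h]; ring

lemma reflect_eq_mirror_add_lattice (l : Fin 2) (ξ : Plane) :
    reflect l ξ = mirror l ξ + lattice (-Pi.single l 1) := by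
  ext i; by_cases h : i = l
  · subst h; simp [mirror, reflect, lattice_apply]; ring
  · simp [mirror, reflect, lattice_apply, h]

lemma preimage_mirror_perforatedPlane (hsymm : mirror l ⁻¹' cell G = cell G) :
    mirror l ⁻¹' perforatedPlane G = perforatedPlane G := by
  have mapsTo : MapsTo (mirror l) (perforatedPlane G) (perforatedPlane G) := by
    rintro ξ ⟨k, hk⟩
    rw [← hsymm, mem_preimage, sub_eq_add_neg, ← lattice_neg, mirror_add_lattice] at hk
    exact (preimage_add_lattice_perforatedPlane _).subset (cell_subset_perforatedPlane G hk)
  exact Subset.antisymm (fun ξ hξ => by simpa only [mirror_mirror] using mapsTo hξ) mapsTo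

lemma preimage_reflect_perforatedPlane (hsymm : mirror l ⁻¹' cell G = cell G) :
    reflect l ⁻¹' perforatedPlane G = perforatedPlane G := by
  have reflect_eq : reflect l = (· + lattice (-Pi.single l 1)) ∘ mirror l :=
    funext (reflect_eq_mirror_add_lattice l)
  rw [reflect_eq, preimage_comp, preimage_add_lattice_perforatedPlane,
    preimage_mirror_perforatedPlane hsymm]

/-- The sign by which the reflection `S_l` changes the `i`-th coordinate. -/
def reflectSign (l i : Fin 2) : ℝ := if i = l then -1 else 1

lemma reflectSign_mul_self (l i : Fin 2) : reflectSign l i * reflectSign l i = 1 := by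
  by_cases h : i = l <;> simp [reflectSign, h]

/-- The reflection `S_l` as a linear isometry. -/
noncomputable def reflectIsometry (l : Fin 2) : Plane ≃ₗᵢ[ℝ] Plane :=
  LinearIsometryEquiv.piLpCongrRight 2 fun i =>
    if i = l then LinearIsometryEquiv.neg ℝ else LinearIsometryEquiv.refl ℝ ℝ

lemma coe_reflectIsometry (l : Fin 2) : (reflectIsometry l : Plane → Plane) = reflect l := by
  funext ξ
  ext i
  by_cases h : i = l <;> simp [reflectIsometry, reflect, h]

/-- The reflection in the line `ξ_l = 1/2` as an affine isometry. -/
noncomputable def mirrorIsometry (l : Fin 2) : Plane ≃ᵃⁱ[ℝ] Plane :=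
  (reflectIsometry l).toAffineIsometryEquiv.trans
    (AffineIsometryEquiv.vaddConst ℝ (lattice (Pi.single l 1)))

lemma coe_mirrorIsometry (l : Fin 2) : (mirrorIsometry l : Plane → Plane) = mirror l := by
  funext ξ
  change reflectIsometry l ξ + lattice (Pi.single l 1) = mirror l ξ
  rw [coe_reflectIsometry, reflect_eq_mirror_add_lattice, lattice_neg, neg_add_cancel_right]

lemma mirrorIsometry_linear_single (l i : Fin 2) :
    (mirrorIsometry l).linearIsometryEquiv (EuclideanSpace.single i 1) =
      reflectSign l i • (EuclideanSpace.single i 1 : Plane) := by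
  change reflectIsometry l _ = _
  rw [coe_reflectIsometry]
  ext j
  rcases eq_or_ne j i with rfl | h
  · by_cases h' : j = l <;> simp [reflect, reflectSign, h']
  · simp [reflect, h]

lemma measurableEmbedding_mirror (l : Fin 2) : MeasurableEmbedding (mirror l) := by
  rw [← coe_mirrorIsometry]
  exact (mirrorIsometry l).toHomeomorph.measurableEmbedding

lemma measurePreserving_mirror_restrict (hA : mirror l ⁻¹' A = A) :
    MeasurePreserving (mirror l) (volume.restrict A) (volume.restrict A) := by
  have h := measurePreserving_affineIsometryEquiv (mirrorIsometry l)
  rw [coe_mirrorIsometry] at h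
  simpa only [hA] using h.restrict_preimage_emb (measurableEmbedding_mirror l) A

lemma setIntegral_comp_mirror {F : Type*} [NormedAddCommGroup F] [NormedSpace ℝ F]
    (hA : mirror l ⁻¹' A = A) (f : Plane → F) :
    ∫ ξ in A, f (mirror l ξ) = ∫ ξ in A, f ξ :=
  (measurePreserving_mirror_restrict hA).integral_comp (measurableEmbedding_mirror l) f

end Mirror

/-! ### Periodic Sobolev functions -/

namespace MemH1per

variable {G : Set Plane} {u v : Plane → ℝ} {du dv : Fin 2 → Plane → ℝ}

lemma const (G : Set Plane) (c : ℝ) : MemH1per G (fun _ => c) (fun _ _ => 0) where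
  periodic _ := by simp
  memLp := memLp_const c
  memLp_grad _ := memLp_const 0
  weak_grad i := .const _ c i

lemma const_mul (hu : MemH1per G u du) (c : ℝ) :
    MemH1per G (fun ξ => c * u ξ) (fun i ξ => c * du i ξ) where
  periodic k := by filter_upwards [hu.periodic k] with ξ hξ; rw [hξ]
  memLp := hu.memLp.const_mul c
  memLp_grad i := (hu.memLp_grad i).const_mul c
  weak_grad i := (hu.weak_grad i).const_mul c

lemma sub (hu : MemH1per G u du) (hv : MemH1per G v dv) :
    MemH1per G (fun ξ => u ξ - v ξ) (fun i ξ => du i ξ - dv i ξ) where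
  periodic k := by
    filter_upwards [hu.periodic k, hv.periodic k] with ξ huξ hvξ
    rw [huξ, hvξ]
  memLp := hu.memLp.sub hv.memLp
  memLp_grad i := (hu.memLp_grad i).sub (hv.memLp_grad i)
  weak_grad i := (hu.weak_grad i).sub (hv.weak_grad i)

lemma comp_mirror (hu : MemH1per G u du) {l : Fin 2} (hsymm : mirror l ⁻¹' cell G = cell G) :
    MemH1per G (fun ξ => u (mirror l ξ)) (fun i ξ => reflectSign l i * du i (mirror l ξ)) where
  periodic k := by
    have h := (measurePreserving_mirror_restrict
      (preimage_mirror_perforatedPlane hsymm)).quasiMeasurePreserving.ae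
        (hu.periodic fun i => if i = l then -k i else k i)
    filter_upwards [h] with ξ hξ
    rw [mirror_add_lattice, hξ]
  memLp := hu.memLp.comp_measurePreserving (measurePreserving_mirror_restrict hsymm)
  memLp_grad i := ((hu.memLp_grad i).comp_measurePreserving
    (measurePreserving_mirror_restrict hsymm)).const_mul _
  weak_grad i := by
    have h := (hu.weak_grad i).comp_affineIsometryEquiv (mirrorIsometry l)
      (mirrorIsometry_linear_single l i)
    rwa [coe_mirrorIsometry, preimage_mirror_perforatedPlane hsymm] at h

lemma periodic_grad (hu : MemH1per G u du) (hG : closure G ⊆ openSquare) (i : Fin 2)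
    (k : Fin 2 → ℤ) :
    ∀ᵐ ξ ∂volume.restrict (perforatedPlane G), du i (ξ + lattice k) = du i ξ := by
  have h := (hu.weak_grad i).comp_affineIsometryEquiv (σ := 1)
    (AffineIsometryEquiv.vaddConst ℝ (lattice k)) (by rw [one_smul]; rfl)
  change HasWeakPartial ((· + lattice k) ⁻¹' _) _ _ i at h
  rw [preimage_add_lattice_perforatedPlane] at h
  simp only [one_mul] at h
  exact h.ae_unique (hu.weak_grad i) (isOpen_perforatedPlane hG) (hu.periodic k)

theorem ae_eq_zero (hu : MemH1per G u du) (hG : closure G ⊆ openSquare)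
    (hconn : IsConnected (cell G)) (hdu : ∀ i, du i =ᵐ[volume.restrict (cell G)] 0)
    (hmean : ∫ ξ in cell G, u ξ = 0) : u =ᵐ[volume.restrict (perforatedPlane G)] 0 := by
  have hE := isOpen_perforatedPlane hG
  have du_eq_zero (i : Fin 2) : du i =ᵐ[volume.restrict (perforatedPlane G)] 0 := by
    refine ae_perforatedPlane_of_ae_cell (fun k => ?_) (hdu i)
    filter_upwards [hu.periodic_grad hG i k] with ξ hξ using hξ.symm.trans
  obtain ⟨c, hc⟩ : ∃ c, ∀ᵐ ξ, ξ ∈ cell G → u ξ = c :=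
    exists_ae_eq_const_of_isConnected hconn fun ξ hξ =>
      (hasWeakGradientZero_of_hasWeakPartial hu.weak_grad du_eq_zero).exists_eventually_eq_const
        (hu.weak_grad 0).1 hE (cell_subset_perforatedPlane G hξ)
  rw [← ae_restrict_iff' (measurableSet_cell G)] at hc
  have c_eq_zero : c = 0 := by
    simpa [integral_congr_ae hc, measureReal_cell_ne_zero hG] using hmean
  subst c_eq_zero
  refine ae_perforatedPlane_of_ae_cell (fun k => ?_) hc
  filter_upwards [hu.periodic k] with ξ hξ using hξ.symm.trans

end MemH1per

/-! ### Symmetry of weak solutions -/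

/-- `f` is multiplied by `s` under the reflection in the line `ξ_l = 1/2`, almost everywhere on
`A`. -/
def HasMirrorParity (l : Fin 2) (s : ℝ) (A : Set Plane) (f : Plane → ℝ) : Prop :=
  ∀ᵐ ξ ∂volume.restrict A, f (mirror l ξ) = s * f ξ

namespace HasMirrorParity

variable {G A B : Set Plane} {l : Fin 2} {s : ℝ} {f g u : Plane → ℝ} {du : Fin 2 → Plane → ℝ}

lemma mono (hf : HasMirrorParity l s B f) (hAB : A ⊆ B) : HasMirrorParity l s A f :=
  ae_restrict_of_ae_restrict_of_subset hAB hf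

lemma add (hf : HasMirrorParity l s A f) (hg : HasMirrorParity l s A g) :
    HasMirrorParity l s A fun ξ => f ξ + g ξ := by
  filter_upwards [hf, hg] with ξ hfξ hgξ
  rw [hfξ, hgξ, mul_add]

lemma setIntegral_eq (hf : HasMirrorParity l s A f) (hA : mirror l ⁻¹' A = A) :
    ∫ ξ in A, f ξ = s * ∫ ξ in A, f ξ := by
  rw [← integral_const_mul, ← integral_congr_ae hf, setIntegral_comp_mirror hA]

lemma grad (hu : HasMirrorParity l s (perforatedPlane G) u) (hmem : MemH1per G u du)
    (hG : closure G ⊆ openSquare) (hsymm : mirror l ⁻¹' cell G = cell G) (i : Fin 2) :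
    HasMirrorParity l (reflectSign l i * s) (perforatedPlane G) (du i) := by
  have h := ((hmem.comp_mirror hsymm).weak_grad i).ae_unique ((hmem.const_mul s).weak_grad i)
    (isOpen_perforatedPlane hG) hu
  filter_upwards [h] with ξ hξ
  rw [mul_assoc, ← hξ, ← mul_assoc, reflectSign_mul_self, one_mul]

end HasMirrorParity

namespace IsWeakSolution

variable {G : Set Plane} {F₀ F₀' u v : Plane → ℝ} {F F' du dv : Fin 2 → Plane → ℝ} {l : Fin 2}

lemma integral_source_eq_zero (hu : IsWeakSolution G F₀ F u du) : ∫ ξ in cell G, F₀ ξ = 0 := by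
  simpa using (hu.equation _ _ (.const G 1)).symm

lemma integral_eq_zero (hu : IsWeakSolution G F₀ F u du) (hG : closure G ⊆ openSquare) :
    ∫ ξ in cell G, u ξ = 0 := by
  simpa [setAverage_eq, measureReal_cell_ne_zero hG] using hu.mean_zero

lemma const_mul (hu : IsWeakSolution G F₀ F u du) (s : ℝ) :
    IsWeakSolution G (fun ξ => s * F₀ ξ) (fun i ξ => s * F i ξ) (fun ξ => s * u ξ)
      (fun i ξ => s * du i ξ) where
  mem := hu.mem.const_mul s
  equation φ dφ hφ := by
    simp only [mul_assoc, ← Finset.mul_sum, integral_const_mul]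
    rw [← mul_neg, hu.equation φ dφ hφ, mul_sub]
  mean_zero := by
    have h := hu.mean_zero
    simp only [setAverage_eq, smul_eq_mul, integral_const_mul] at h ⊢
    rw [mul_left_comm, h, mul_zero]

lemma congr (hu : IsWeakSolution G F₀ F u du) (h₀ : F₀ =ᵐ[volume.restrict (cell G)] F₀')
    (h : ∀ i, F i =ᵐ[volume.restrict (cell G)] F' i) : IsWeakSolution G F₀' F' u du where
  mem := hu.mem
  equation φ dφ hφ := by
    rw [hu.equation φ dφ hφ]
    congr 1
    · exact integral_congr_ae (by filter_upwards [h₀] with ξ hξ; rw [hξ])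
    · exact integral_congr_ae (by filter_upwards [ae_all_iff.2 h] with ξ hξ; simp only [hξ])
  mean_zero := hu.mean_zero

lemma comp_mirror (hu : IsWeakSolution G F₀ F u du) (hsymm : mirror l ⁻¹' cell G = cell G) :
    IsWeakSolution G (fun ξ => F₀ (mirror l ξ)) (fun i ξ => reflectSign l i * F i (mirror l ξ))
      (fun ξ => u (mirror l ξ)) (fun i ξ => reflectSign l i * du i (mirror l ξ)) where
  mem := hu.mem.comp_mirror hsymm
  equation φ dφ hφ := by
    have h := hu.equation _ _ (hφ.comp_mirror hsymm)
    rw [← setIntegral_comp_mirror hsymm, ← setIntegral_comp_mirror hsymm fun ξ => F₀ ξ * _,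
      ← setIntegral_comp_mirror hsymm fun ξ => ∑ i, F i ξ * _] at h
    simpa only [mirror_mirror, mul_assoc, mul_left_comm] using h
  mean_zero := by
    rw [setAverage_eq, setIntegral_comp_mirror hsymm, ← setAverage_eq, hu.mean_zero]

theorem ae_eq (hu : IsWeakSolution G F₀ F u du) (hv : IsWeakSolution G F₀ F v dv)
    (hG : closure G ⊆ openSquare) (hconn : IsConnected (cell G)) :
    u =ᵐ[volume.restrict (perforatedPlane G)] v := by
  let dw (i : Fin 2) (ξ : Plane) : ℝ := du i ξ - dv i ξ
  have hw : MemH1per G (fun ξ => u ξ - v ξ) dw := hu.mem.sub hv.mem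
  have integrable_mul {dφ : Fin 2 → Plane → ℝ} {φ : Plane → ℝ} (hφ : MemH1per G φ dφ) :
      IntegrableOn (fun ξ => ∑ i, dφ i ξ * dw i ξ) (cell G) :=
    integrable_finsetSum _ fun i _ => (hφ.memLp_grad i).integrable_mul (hw.memLp_grad i)
  have dirichlet_eq_zero : ∫ ξ in cell G, ∑ i, dw i ξ * dw i ξ = 0 := by
    have h : ∫ ξ in cell G, ∑ i, du i ξ * dw i ξ = ∫ ξ in cell G, ∑ i, dv i ξ * dw i ξ :=
      neg_injective ((hu.equation _ _ hw).trans (hv.equation _ _ hw).symm)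
    rw [← sub_eq_zero, ← integral_sub (integrable_mul hu.mem) (integrable_mul hv.mem)] at h
    simpa only [← Finset.sum_sub_distrib, ← sub_mul] using h
  have dw_eq_zero (i : Fin 2) : dw i =ᵐ[volume.restrict (cell G)] 0 := by
    have h := (integral_eq_zero_iff_of_nonneg
      (fun ξ => Finset.sum_nonneg fun i _ => mul_self_nonneg (dw i ξ))
      (integrable_mul hw)).1 dirichlet_eq_zero
    filter_upwards [h] with ξ hξ
    exact mul_self_eq_zero.1 <| (Finset.sum_eq_zero_iff_of_nonneg
      fun i _ => mul_self_nonneg (dw i ξ)).1 hξ i (Finset.mem_univ i)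
  have mean_eq_zero : ∫ ξ in cell G, (u ξ - v ξ) = 0 := by
    rw [integral_sub (hu.mem.memLp.integrable one_le_two) (hv.mem.memLp.integrable one_le_two),
      hu.integral_eq_zero hG, hv.integral_eq_zero hG, sub_zero]
  exact (sub_ae_eq_zero _ _).1 (hw.ae_eq_zero hG hconn dw_eq_zero mean_eq_zero)

theorem hasMirrorParity (hu : IsWeakSolution G F₀ F u du) (hG : closure G ⊆ openSquare)
    (hconn : IsConnected (cell G)) (hsymm : mirror l ⁻¹' cell G = cell G) {s : ℝ}
    (hF₀ : HasMirrorParity l s (cell G) F₀)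
    (hF : ∀ i, HasMirrorParity l (reflectSign l i * s) (cell G) (F i)) :
    HasMirrorParity l s (perforatedPlane G) u := by
  refine ((hu.comp_mirror hsymm).congr hF₀ fun i => ?_).ae_eq (hu.const_mul s) hG hconn
  filter_upwards [hF i] with ξ hξ
  rw [hξ, ← mul_assoc, ← mul_assoc, reflectSign_mul_self, one_mul]

end IsWeakSolution

/-! ### Symmetry of the correctors -/

lemma neg_one_pow_count_cons (l a : Fin 2) (β : List (Fin 2)) :
    (-1 : ℝ) ^ (a :: β).count l = reflectSign l a * (-1) ^ β.count l := by
  by_cases h : a = l <;> simp [reflectSign, h, pow_succ]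

lemma reflectSign_mul_neg_one_pow_count_cons (l a : Fin 2) (β : List (Fin 2)) :
    reflectSign l a * (-1 : ℝ) ^ (a :: β).count l = (-1) ^ β.count l := by
  rw [neg_one_pow_count_cons, ← mul_assoc, reflectSign_mul_self, one_mul]

lemma exists_odd_count_of_odd_length {ι : Type*} [DecidableEq ι] {α : List ι}
    (hα : Odd α.length) : ∃ i, Odd (α.count i) := by
  by_contra! h
  refine Nat.not_even_iff_odd.2 hα ?_
  rw [← Multiset.coe_card, ← Multiset.toFinset_sum_count_eq]
  exact Finset.even_sum _ fun i _ => by simpa using h i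

/-- For words of length at least two the term `F₀` of the corrector problem, `source`, is the
constant `h_{abγ}` minus this function, which only involves correctors of shorter words. -/
def lowerOrderTerm (N : List (Fin 2) → Plane → ℝ) (DN : List (Fin 2) → Fin 2 → Plane → ℝ)
    (a b : Fin 2) (γ : List (Fin 2)) (ξ : Plane) : ℝ :=
  (if a = b then N γ ξ else 0) + DN (b :: γ) a ξ

lemma source_eq_sub_lowerOrderTerm (N : List (Fin 2) → Plane → ℝ)
    (DN : List (Fin 2) → Fin 2 → Plane → ℝ) (h : List (Fin 2) → ℝ) (a b : Fin 2)
    (γ : List (Fin 2)) :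
    source N DN h (a :: b :: γ) = fun ξ => h (a :: b :: γ) - lowerOrderTerm N DN a b γ ξ :=
  funext fun _ => sub_sub _ _ _

lemma HasMirrorParity.flux {A : Set Plane} {N : List (Fin 2) → Plane → ℝ} {l : Fin 2}
    {β : List (Fin 2)} (hβ : HasMirrorParity l ((-1) ^ β.count l) A (N β)) (a i : Fin 2) :
    HasMirrorParity l (reflectSign l i * (-1) ^ (a :: β).count l) A (flux N (a :: β) i) := by
  filter_upwards [hβ] with ξ hξ
  by_cases hia : i = a
  · simp only [CellProblem.flux, if_pos hia]
    rw [hξ, hia, reflectSign_mul_neg_one_pow_count_cons, mul_neg]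
  · simp only [CellProblem.flux, if_neg hia, mul_zero]

namespace IsCellCorrectors

variable {G : Set Plane} {N : List (Fin 2) → Plane → ℝ} {DN : List (Fin 2) → Fin 2 → Plane → ℝ}
  {h : List (Fin 2) → ℝ} {l : Fin 2}

lemma memH1per (hN : IsCellCorrectors G N DN h) (a : Fin 2) (β : List (Fin 2)) :
    MemH1per G (N (a :: β)) (DN (a :: β)) :=
  (hN.solves (a :: β) (by simp)).mem

lemma memLp (hN : IsCellCorrectors G N DN h) :
    ∀ α, MemLp (N α) 2 (volume.restrict (cell G))
  | [] => by rw [show N [] = fun _ => 1 from funext hN.empty]; exact memLp_const 1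
  | a :: β => (hN.memH1per a β).memLp

lemma periodic (hN : IsCellCorrectors G N DN h) (k : Fin 2 → ℤ) :
    ∀ α, ∀ᵐ ξ ∂volume.restrict (perforatedPlane G), N α (ξ + lattice k) = N α ξ
  | [] => .of_forall fun ξ => by rw [hN.empty, hN.empty]
  | a :: β => (hN.memH1per a β).periodic k

lemma integrable_lowerOrderTerm (hN : IsCellCorrectors G N DN h) (a b : Fin 2)
    (γ : List (Fin 2)) : IntegrableOn (lowerOrderTerm N DN a b γ) (cell G) := by
  refine .add ?_ (((hN.memH1per b γ).memLp_grad a).integrable one_le_two)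
  by_cases hab : a = b
  · simp only [if_pos hab]
    exact (hN.memLp γ).integrable one_le_two
  · simp only [if_neg hab]
    exact integrable_zero _ _ _

lemma integral_lowerOrderTerm (hN : IsCellCorrectors G N DN h) (a b : Fin 2) (γ : List (Fin 2)) :
    ∫ ξ in cell G, lowerOrderTerm N DN a b γ ξ = volume.real (cell G) * h (a :: b :: γ) := by
  have h₀ := (hN.solves (a :: b :: γ) (by simp)).integral_source_eq_zero
  rw [source_eq_sub_lowerOrderTerm,
    integral_sub (integrable_const _) (hN.integrable_lowerOrderTerm a b γ), setIntegral_const,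
    smul_eq_mul] at h₀
  exact (sub_eq_zero.1 h₀).symm

section Parity

variable {a b : Fin 2} {γ : List (Fin 2)}

lemma hasMirrorParity_lowerOrderTerm (hN : IsCellCorrectors G N DN h)
    (hG : closure G ⊆ openSquare) (hsymm : mirror l ⁻¹' cell G = cell G)
    (hγ : HasMirrorParity l ((-1) ^ γ.count l) (perforatedPlane G) (N γ))
    (hbγ : HasMirrorParity l ((-1) ^ (b :: γ).count l) (perforatedPlane G) (N (b :: γ))) :
    HasMirrorParity l ((-1) ^ (a :: b :: γ).count l) (cell G) (lowerOrderTerm N DN a b γ) := by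
  refine .mono (.add ?_ ?_) (cell_subset_perforatedPlane G)
  · filter_upwards [hγ] with ξ hξ
    by_cases hab : a = b
    · rw [if_pos hab, if_pos hab, hξ, neg_one_pow_count_cons, hab,
        reflectSign_mul_neg_one_pow_count_cons]
    · rw [if_neg hab, if_neg hab, mul_zero]
  · rw [neg_one_pow_count_cons]
    exact hbγ.grad (hN.memH1per b γ) hG hsymm a

lemma constant_eq_neg_one_pow_count_mul (hN : IsCellCorrectors G N DN h)
    (hG : closure G ⊆ openSquare) (hsymm : mirror l ⁻¹' cell G = cell G)
    (hγ : HasMirrorParity l ((-1) ^ γ.count l) (perforatedPlane G) (N γ))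
    (hbγ : HasMirrorParity l ((-1) ^ (b :: γ).count l) (perforatedPlane G) (N (b :: γ))) :
    h (a :: b :: γ) = (-1) ^ (a :: b :: γ).count l * h (a :: b :: γ) := by
  have integral_eq :=
    (hN.hasMirrorParity_lowerOrderTerm (a := a) hG hsymm hγ hbγ).setIntegral_eq hsymm
  rw [hN.integral_lowerOrderTerm, mul_left_comm] at integral_eq
  exact mul_left_cancel₀ (measureReal_cell_ne_zero hG) integral_eq

end Parity

theorem hasMirrorParity (hN : IsCellCorrectors G N DN h) (hG : closure G ⊆ openSquare)
    (hconn : IsConnected (cell G)) (hsymm : mirror l ⁻¹' cell G = cell G) :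
    ∀ α, HasMirrorParity l ((-1) ^ α.count l) (perforatedPlane G) (N α)
  | [] => .of_forall fun ξ => by simp [hN.empty]
  | [a] => by
      have h_empty := hN.hasMirrorParity hG hconn hsymm []
      refine (hN.solves [a] le_rfl).hasMirrorParity hG hconn hsymm (.of_forall fun ξ => ?_)
        ((h_empty.mono (cell_subset_perforatedPlane G)).flux a)
      simp only [source, mul_zero]
  | a :: b :: γ => by
      have hγ := hN.hasMirrorParity hG hconn hsymm γ
      have hbγ := hN.hasMirrorParity hG hconn hsymm (b :: γ)
      refine (hN.solves (a :: b :: γ) (by simp)).hasMirrorParity hG hconn hsymm ?_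
        ((hbγ.mono (cell_subset_perforatedPlane G)).flux a)
      rw [source_eq_sub_lowerOrderTerm]
      filter_upwards [hN.hasMirrorParity_lowerOrderTerm (a := a) hG hsymm hγ hbγ] with ξ hξ
      rw [hξ, mul_sub, ← hN.constant_eq_neg_one_pow_count_mul hG hsymm hγ hbγ]

theorem ae_reflect (hN : IsCellCorrectors G N DN h) (hG : closure G ⊆ openSquare)
    (hconn : IsConnected (cell G)) (hsymm : mirror l ⁻¹' cell G = cell G)
    (α : List (Fin 2)) :
    ∀ᵐ ξ ∂volume.restrict (perforatedPlane G),
      N α (reflect l ξ) = (-1) ^ α.count l * N α ξ := by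
  have periodic_mirror := (measurePreserving_mirror_restrict
    (preimage_mirror_perforatedPlane hsymm)).quasiMeasurePreserving.ae
      (hN.periodic (-Pi.single l 1) α)
  filter_upwards [periodic_mirror, hN.hasMirrorParity hG hconn hsymm α] with ξ hper hmir
  rw [reflect_eq_mirror_add_lattice, hper, hmir]

theorem reflect_of_continuousOn (hN : IsCellCorrectors G N DN h) (hG : closure G ⊆ openSquare)
    (hconn : IsConnected (cell G)) (hsymm : mirror l ⁻¹' cell G = cell G)
    {α : List (Fin 2)} (hcont : ContinuousOn (N α) (closure (perforatedPlane G))) :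
    ∀ ξ ∈ closure (perforatedPlane G),
      N α (reflect l ξ) = (-1) ^ α.count l * N α ξ := by
  have continuous_reflect : Continuous (reflect l) := by
    rw [← coe_reflectIsometry]
    exact (reflectIsometry l).continuous
  have mapsTo_reflect :
      MapsTo (reflect l) (closure (perforatedPlane G)) (closure (perforatedPlane G)) :=
    MapsTo.closure (preimage_reflect_perforatedPlane hsymm).ge continuous_reflect
  exact eqOn_closure_of_ae_eq (isOpen_perforatedPlane hG) (hN.ae_reflect hG hconn hsymm α)
    (hcont.comp continuous_reflect.continuousOn mapsTo_reflect) (continuousOn_const.mul hcont)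

theorem constant_eq_zero (hN : IsCellCorrectors G N DN h) (hG : closure G ⊆ openSquare)
    (hconn : IsConnected (cell G)) (hsymm : mirror l ⁻¹' cell G = cell G) :
    ∀ {α : List (Fin 2)}, 2 ≤ α.length → Odd (α.count l) → h α = 0
  | a :: b :: γ, _, hodd => by
    have h_eq := hN.constant_eq_neg_one_pow_count_mul (a := a) hG hsymm
      (hN.hasMirrorParity hG hconn hsymm γ) (hN.hasMirrorParity hG hconn hsymm (b :: γ))
    rw [hodd.neg_one_pow, neg_one_mul] at h_eq
    exact self_eq_neg.1 h_eq

end IsCellCorrectors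

end CellProblem

open CellProblem in
theorem lemma3p3_general {G : Set Plane} (hG : closure G ⊆ openSquare)
    (hconn : IsConnected (cell G)) (hsymm : ∀ l, mirror l ⁻¹' cell G = cell G)
    {N : List (Fin 2) → Plane → ℝ} {DN : List (Fin 2) → Fin 2 → Plane → ℝ}
    {h : List (Fin 2) → ℝ} (hN : IsCellCorrectors G N DN h) :
    (∀ (α : List (Fin 2)) (l : Fin 2),
      (∀ᵐ ξ ∂volume.restrict (perforatedPlane G),
        N α (reflect l ξ) = (-1) ^ α.count l * N α ξ) ∧
      (ContinuousOn (N α) (closure (perforatedPlane G)) →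
        ∀ ξ ∈ closure (perforatedPlane G),
          N α (reflect l ξ) = (-1) ^ α.count l * N α ξ)) ∧
    (∀ α : List (Fin 2), 2 ≤ α.length → Odd α.length → h α = 0) ∧
    (∀ α : List (Fin 2), 2 ≤ α.length →
      (∃ l : Fin 2, (-1 : ℤ) ^ α.count l = -1) → h α = 0) := by
  refine ⟨fun α l => ⟨hN.ae_reflect hG hconn (hsymm l) α,
    hN.reflect_of_continuousOn hG hconn (hsymm l)⟩, fun α hα hodd => ?_, fun α hα ⟨l, hl⟩ => ?_⟩
  · obtain ⟨l, hl⟩ := exists_odd_count_of_odd_length hodd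
    exact hN.constant_eq_zero hG hconn (hsymm l) hα hl
  · exact hN.constant_eq_zero hG hconn (hsymm l) hα
      ((neg_one_pow_eq_neg_one_iff_odd (by decide)).1 hl)

theorem lemma3p3 (G : Set CellProblem.Plane) (hG : CellProblem.IsSymmetricPerforation G)
    (N : List (Fin 2) → CellProblem.Plane → ℝ)
    (DN : List (Fin 2) → Fin 2 → CellProblem.Plane → ℝ) (h : List (Fin 2) → ℝ)
    (hN : CellProblem.IsCellCorrectors G N DN h) :
    (∀ α : List (Fin 2), 1 ≤ α.length → ∀ l : Fin 2,
      (∀ᵐ ξ ∂(volume.restrict (CellProblem.perforatedPlane G)),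
        N α (CellProblem.reflect l ξ) = (-1) ^ α.count l * N α ξ) ∧
      (ContinuousOn (N α) (closure (CellProblem.perforatedPlane G)) →
        ∀ ξ ∈ closure (CellProblem.perforatedPlane G),
          N α (CellProblem.reflect l ξ) = (-1) ^ α.count l * N α ξ)) ∧
    (∀ α : List (Fin 2), 2 ≤ α.length → Odd α.length → h α = 0) ∧
    (∀ α : List (Fin 2), 2 ≤ α.length →
      (∃ l : Fin 2, (-1 : ℤ) ^ α.count l = -1) → h α = 0) := by
  obtain ⟨parity, odd_length, odd_count⟩ :=
    lemma3p3_general hG.strictly_inside hG.connected hG.symmetric hN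
  exact ⟨fun α _ => parity α, odd_length, odd_count⟩
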